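/- Let $H$ be a complex Hilbert space, $H\hat\otimes_2 H$ the Hilbertian tensor product (the completion of $H\otimes_{\mathbb C}H$ for the inner product with $\langle u\otimes v,u'\otimes v'\rangle=\langle u,u'\rangle\langle v,v'\rangle$), and let $\mu\colon H\hat\otimes_2 H\to H$ be a bounded linear map whose product $xy:=\mu(x\otimes y)$ is associative and commutative; no unit is assumed, and neither is the Frobenius condition. Let $\mu^\dagger\colon H\to H\hat\otimes_2 H$ be the Hilbert adjoint of $\mu$, and assume that $(H,\mu)$ is special, that is, $\mu\circ\mu^\dagger=\mathrm{id}_H$. Let $J$ be the Jacobson radical of $(H,\mu)$, that is, the intersection of all its maximal modular ideals ($J=H$ if there are none); an ideal $I$ is modular if there is $u\in H$ with $x-ux\in I$ for all $x\in H$. Let $G=\{x\in H\setminus\{0\} : \mu^\dagger(x)=x\otimes x\}$ be the set of group-like elements. For a closed subspace $V$ of $H$, view $V\hat\otimes_2 V$ as the closed subspace of $H\hat\otimes_2 H$ which is the range of the map $V\hat\otimes_2 V\to H\hat\otimes_2 H$ induced by the inclusion. Then: 1. $J$ is closed and $H=J\oplus_2 J^\perp$ (orthogonal direct sum of Hilbert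 spaces). 2. $J^\perp$ is a closed subalgebra of $(H,\mu)$: $\mu(J^\perp\hat\otimes_2 J^\perp)\subseteq J^\perp$. 3. $J^\perp$ is a closed subcoalgebra of $(H,\mu)$: $\mu^\dagger(J^\perp)\subseteq J^\perp\hat\otimes_2 J^\perp$. 4. For all $x,y\in G$, $xy=\delta_{x,y}\,x$, that is, $xx=x$, and $xy=0$ if $x\neq y$. -/

import Mathlib

open scoped TensorProduct

noncomputable section

namespace Hilbertian

section Tensor

variable (H K : Type*) [NormedAddCommGroup H] [InnerProductSpace ℂ H]
  [NormedAddCommGroup K] [InnerProductSpace ℂ K]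

/-- The Hilbertian tensor product: the completion of the algebraic tensor product for the inner
product determined by `⟪u ⊗ v, u' ⊗ v'⟫ = ⟪u, u'⟫ * ⟪v, v'⟫`. -/
abbrev HTensor : Type _ := UniformSpace.Completion (H ⊗[ℂ] K)

variable {H K}

/-- The elementary tensor `x ⊗ y` in the Hilbertian tensor product. -/
def tmul (x : H) (y : K) : HTensor H K := ((x ⊗ₜ[ℂ] y : H ⊗[ℂ] K) : HTensor H K)

/-- The Hilbertian tensor product `i ⊗ j` of two linear isometries: the bounded linear extension
of `v ⊗ w ↦ i v ⊗ j w`. -/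
def mapTensor {V W : Type*} [NormedAddCommGroup V] [InnerProductSpace ℂ V]
    [NormedAddCommGroup W] [InnerProductSpace ℂ W] (i : V →ₗᵢ[ℂ] H) (j : W →ₗᵢ[ℂ] K) :
    HTensor V W →L[ℂ] HTensor H K :=
  (TensorProduct.mapIsometry i j).toContinuousLinearMap.completion

/-- `mapTensor` acts on elementary tensors as it should. -/
theorem mapTensor_tmul {V W : Type*} [NormedAddCommGroup V] [InnerProductSpace ℂ V]
    [NormedAddCommGroup W] [InnerProductSpace ℂ W] (i : V →ₗᵢ[ℂ] H) (j : W →ₗᵢ[ℂ] K)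
    (v : V) (w : W) : mapTensor i j (tmul v w) = tmul (i v) (j w) := by
  simp [mapTensor, tmul]

/-- The Hilbertian tensor product of two subspaces, as a subspace of the Hilbertian tensor product
of the ambient spaces: the range of the map induced by the inclusions. -/
def subTensor (V : Submodule ℂ H) (W : Submodule ℂ K) : Submodule ℂ (HTensor H K) :=
  LinearMap.range (mapTensor V.subtypeₗᵢ W.subtypeₗᵢ).toLinearMap

end Tensor

/-- A Hilbertian algebra structure on a Hilbert space `H`: a bounded linear multiplication
defined on the Hilbertian tensor product, associative and commutative (by linearity and continuity,
it suffices to say so on elementary tensors). No unit is required. -/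
structure HilbertianAlgebra (H : Type*) [NormedAddCommGroup H] [InnerProductSpace ℂ H]
    [CompleteSpace H] where
  μ : HTensor H H →L[ℂ] H
  assoc : ∀ x y z : H, μ (tmul (μ (tmul x y)) z) = μ (tmul x (μ (tmul y z)))
  comm : ∀ x y : H, μ (tmul x y) = μ (tmul y x)

namespace HilbertianAlgebra

variable {H : Type*} [NormedAddCommGroup H] [InnerProductSpace ℂ H] [CompleteSpace H]
  (A : HilbertianAlgebra H)

/-- The product `xy = μ (x ⊗ y)`. -/
def mul (x y : H) : H := A.μ (tmul x y)

/-- The comultiplication: the Hilbert adjoint of the multiplication. -/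
def comul : H →L[ℂ] HTensor H H := ContinuousLinearMap.adjoint A.μ

/-- A Hilbertian algebra is special when `μ ∘ μ† = id`. -/
def IsSpecial : Prop := A.μ ∘L A.comul = ContinuousLinearMap.id ℂ H

/-- Ideals of the underlying algebra: not necessarily closed subspaces stable under multiplication
by arbitrary elements (one side suffices, by commutativity). -/
def IsIdeal (I : Submodule ℂ H) : Prop := ∀ x : H, ∀ y ∈ I, A.mul x y ∈ I

/-- Modular ideals: those for which the quotient algebra has a unit. -/
def IsModularIdeal (I : Submodule ℂ H) : Prop :=
  A.IsIdeal I ∧ ∃ u : H, ∀ x : H, x - A.mul u x ∈ I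

/-- Maximal modular ideals: modular ideals that are maximal among the proper ideals. -/
def IsMaximalModularIdeal (I : Submodule ℂ H) : Prop :=
  A.IsModularIdeal I ∧ I ≠ ⊤ ∧ ∀ K : Submodule ℂ H, A.IsIdeal K → I < K → K = ⊤

/-- The Jacobson radical: the intersection of all maximal modular ideals (the whole space when
there are none). -/
def jacobson : Submodule ℂ H := sInf {I | A.IsMaximalModularIdeal I}

/-- The group-like elements: the non-zero `x` with `μ† x = x ⊗ x`. -/
def groupLike : Set H := {x | x ≠ 0 ∧ A.comul x = tmul x x}

/-- A (closed) subalgebra: a closed subspace `V` with `μ (V ⊗ V) ⊆ V`. -/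
def IsSubalgebra (V : Submodule ℂ H) : Prop :=
  IsClosed (V : Set H) ∧ ∀ t ∈ subTensor V V, A.μ t ∈ V

/-- A (closed) subcoalgebra: a closed subspace `V` with `μ† V ⊆ V ⊗ V`. -/
def IsSubcoalgebra (V : Submodule ℂ H) : Prop :=
  IsClosed (V : Set H) ∧ ∀ x ∈ V, A.comul x ∈ subTensor V V

end HilbertianAlgebra

/-- `H` is the (internal) orthogonal direct sum of the Hilbert spaces `V` and `W`. -/
def IsOrthogonalDirectSum {H : Type*} [NormedAddCommGroup H] [InnerProductSpace ℂ H]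
    (V W : Submodule ℂ H) : Prop :=
  IsClosed (V : Set H) ∧ IsClosed (W : Set H) ∧ V ⟂ W ∧ IsCompl V W

end Hilbertian

end

open scoped TensorProduct InnerProductSpace

/-! Specialness makes the adjoint of the product isometric, so the product is contractive and `H` is
a commutative Banach algebra. By Riesz, characters are exactly the functionals `⟪g, ·⟫` with `g`
group-like (`comul_eq_tmul_iff`). Hence maximal modular ideals are the hyperplanes orthogonal to
such `g`, `J` is the orthogonal complement of `G` (`jacobson_eq`), and `Jᗮ` is the closed span of
`G`. It remains to compute products in `G`: specialness gives `gg = g`, and for `x ≠ y` the element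
`xy` is an idempotent killed by every character, hence zero (`eq_zero_of_idempotent`). -/

/-- A proper modular ideal of a commutative complex Banach algebra is annihilated by a character,
which takes the value `1` at any modular unit. -/
theorem exists_character_of_modular {B : Type*} [NonUnitalNormedCommRing B] [NormedSpace ℂ B]
    [IsScalarTower ℂ B B] [SMulCommClass ℂ B B] [CompleteSpace B] (I : Submodule ℂ B)
    (hI : ∀ x, ∀ y ∈ I, x * y ∈ I) (hne : I ≠ ⊤) {u : B} (hu : ∀ x, x - u * x ∈ I) :
    ∃ φ : B →L[ℂ] ℂ, (∀ x y, φ (x * y) = φ x * φ y) ∧ (∀ x ∈ I, φ x = 0) ∧ φ u = 1 := by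
  -- The `ℓ¹` norm makes the unitization a Banach algebra containing `B` isometrically.
  let U := WithLp 1 (Unitization ℂ B)
  let _ : NormedCommRing U :=
    { (inferInstance : NormedRing (WithLp 1 (Unitization ℂ B))) with
      mul_comm := fun a b => WithLp.ofLp_injective 1 (mul_comm a.ofLp b.ofLp) }
  let _ : NormedAlgebra ℂ U := WithLp.instUnitizationNormedAlgebra
  have : CompleteSpace U := WithLp.instCompleteSpace ℂ B
  -- The kernel of the unital map `U → B/I`, `c + b ↦ c u + b`; it contains `1 - u`.
  let N : Ideal U :=
    { carrier := {a | a.ofLp.fst • u + a.ofLp.snd ∈ I}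
      zero_mem' := by
        change (0 : Unitization ℂ B).fst • u + (0 : Unitization ℂ B).snd ∈ I
        simp
      add_mem' := by
        intro a b ha hb
        have h := I.add_mem ha hb
        change (a.ofLp + b.ofLp).fst • u + (a.ofLp + b.ofLp).snd ∈ I
        convert h using 1
        simp only [Unitization.fst_add, Unitization.snd_add, add_smul]
        abel
      smul_mem' := by
        intro a b hb
        change (a.ofLp * b.ofLp).fst • u + (a.ofLp * b.ofLp).snd ∈ I
        have hb' : b.ofLp.fst • u + b.ofLp.snd ∈ I := hb
        -- With `a = α + a'` and `b = β + b'`, the product maps to `α(βu + b') + a'(βu + b') + β(a'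
        -- - ua')`.
        have h := I.add_mem (I.add_mem (I.smul_mem a.ofLp.fst hb') (hI a.ofLp.snd _ hb'))
          (I.smul_mem b.ofLp.fst (hu a.ofLp.snd))
        convert h using 1
        simp only [Unitization.fst_mul, Unitization.snd_mul, mul_smul, smul_add, smul_sub, mul_add,
          mul_smul_comm, mul_comm u]
        abel }
  have hN : N ≠ ⊤ := by
    intro h
    have h1 : (1 : U) ∈ N := h ▸ Submodule.mem_top
    have h2 : (1 : Unitization ℂ B).fst • u + (1 : Unitization ℂ B).snd ∈ I := h1
    have hu' : u ∈ I := by simpa using h2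
    refine hne (eq_top_iff.2 fun x _ => ?_)
    have h3 := I.add_mem (hu x) (hI x u hu')
    rwa [mul_comm x u, sub_add_cancel] at h3
  obtain ⟨M, hM, hNM⟩ := N.exists_le_maximal hN
  let χ := M.toCharacterSpace
  let ι : B →L[ℂ] U :=
    LinearMap.mkContinuous
      { toFun := fun x => WithLp.toLp 1 (x : Unitization ℂ B)
        map_add' := fun x y => WithLp.ofLp_injective 1 (Unitization.inr_add ℂ x y)
        map_smul' := fun c x => WithLp.ofLp_injective 1 (Unitization.inr_smul ℂ c x) } 1
      fun x => by rw [one_mul]; exact (WithLp.unitization_norm_inr x).le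
  have hι (x : B) : ι x = WithLp.toLp 1 (x : Unitization ℂ B) := rfl
  have hιmul (x y : B) : ι (x * y) = ι x * ι y :=
    WithLp.ofLp_injective 1 (Unitization.inr_mul ℂ x y)
  refine ⟨(WeakDual.CharacterSpace.toCLM χ).comp ι, fun x y => ?_, fun x hx => ?_, ?_⟩
  · change χ (ι (x * y)) = χ (ι x) * χ (ι y)
    rw [hιmul, map_mul]
  · refine M.toCharacterSpace_apply_eq_zero_of_mem (hNM ?_)
    change (x : Unitization ℂ B).fst • u + (x : Unitization ℂ B).snd ∈ I
    simpa using hx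
  · change χ (ι u) = 1
    have h1 : (1 : U) - ι u ∈ N := by
      change (1 - 0 : ℂ) • u + (0 - u) ∈ I
      simp
    have h2 : χ (1 - ι u) = 0 := M.toCharacterSpace_apply_eq_zero_of_mem (hNM h1)
    rw [map_sub, map_one, sub_eq_zero] at h2
    exact h2.symm

/-- The commutative normed ring structure given by a product on a normed group. -/
abbrev NonUnitalNormedCommRing.ofMul {E : Type*} [NormedAddCommGroup E] (m : E → E → E)
    (mul_add : ∀ x y z, m x (y + z) = m x y + m x z)
    (add_mul : ∀ x y z, m (x + y) z = m x z + m y z)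
    (zero_mul : ∀ x, m 0 x = 0) (mul_zero : ∀ x, m x 0 = 0)
    (mul_assoc : ∀ x y z, m (m x y) z = m x (m y z)) (mul_comm : ∀ x y, m x y = m y x)
    (norm_mul_le : ∀ x y, ‖m x y‖ ≤ ‖x‖ * ‖y‖) : NonUnitalNormedCommRing E :=
  { ‹NormedAddCommGroup E› with
    mul := m
    left_distrib := mul_add
    right_distrib := add_mul
    zero_mul := zero_mul
    mul_zero := mul_zero
    mul_assoc := mul_assoc
    mul_comm := mul_comm
    norm_mul_le := norm_mul_le }

namespace Hilbertian

/-! ### Elementary tensors and subspaces of the Hilbertian tensor product -/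

section Tensor

variable {H K : Type*} [NormedAddCommGroup H] [InnerProductSpace ℂ H]
  [NormedAddCommGroup K] [InnerProductSpace ℂ K]

theorem inner_tmul_tmul (x x' : H) (y y' : K) :
    ⟪tmul x y, tmul x' y'⟫_ℂ = ⟪x, x'⟫_ℂ * ⟪y, y'⟫_ℂ := by
  simp [tmul, UniformSpace.Completion.inner_coe]

theorem norm_tmul (x : H) (y : K) : ‖tmul x y‖ = ‖x‖ * ‖y‖ := by
  simp [tmul]

theorem tmul_add (x : H) (y z : K) : tmul x (y + z) = tmul x y + tmul x z := by
  simp only [tmul, TensorProduct.tmul_add, UniformSpace.Completion.coe_add]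

theorem add_tmul (x y : H) (z : K) : tmul (x + y) z = tmul x z + tmul y z := by
  simp only [tmul, TensorProduct.add_tmul, UniformSpace.Completion.coe_add]

theorem tmul_smul (c : ℂ) (x : H) (y : K) : tmul x (c • y) = c • tmul x y := by
  simp only [tmul, TensorProduct.tmul_smul, UniformSpace.Completion.coe_smul]

theorem smul_tmul (c : ℂ) (x : H) (y : K) : tmul (c • x) y = c • tmul x y := by
  rw [tmul, tmul, ← UniformSpace.Completion.coe_smul, TensorProduct.smul_tmul']

/-- Bounded linear maps on the Hilbertian tensor product are determined by elementary tensors. -/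
theorem HTensor.clm_ext {E : Type*} [NormedAddCommGroup E] [NormedSpace ℂ E]
    {f g : HTensor H K →L[ℂ] E} (h : ∀ x y, f (tmul x y) = g (tmul x y)) : f = g := by
  ext t
  induction t using UniformSpace.Completion.induction_on with
  | hp => exact isClosed_eq f.continuous g.continuous
  | ih a =>
    induction a using TensorProduct.induction_on with
    | zero => exact (map_zero f).trans (map_zero g).symm
    | tmul x y => exact h x y
    | add a b ha hb => rw [UniformSpace.Completion.coe_add, map_add, map_add, ha, hb]

theorem isClosed_subTensor [CompleteSpace H] [CompleteSpace K] (V : Submodule ℂ H)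
    (W : Submodule ℂ K) : IsClosed (subTensor V W : Set (HTensor H K)) := by
  have h : Isometry (mapTensor V.subtypeₗᵢ W.subtypeₗᵢ) :=
    (TensorProduct.mapIsometry V.subtypeₗᵢ W.subtypeₗᵢ).isometry.completion_map
  have hr : (subTensor V W : Set (HTensor H K)) =
      Set.range (mapTensor V.subtypeₗᵢ W.subtypeₗᵢ) := LinearMap.coe_range _
  rw [hr]
  exact h.isClosedEmbedding.isClosed_range

theorem tmul_mem_subTensor {V : Submodule ℂ H} {W : Submodule ℂ K} {x : H} {y : K} (hx : x ∈ V)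
    (hy : y ∈ W) : tmul x y ∈ subTensor V W :=
  ⟨tmul ⟨x, hx⟩ ⟨y, hy⟩, mapTensor_tmul _ _ _ _⟩

end Tensor

/-! ### Group-like elements as characters -/

namespace HilbertianAlgebra

variable {H : Type*} [NormedAddCommGroup H] [InnerProductSpace ℂ H] [CompleteSpace H]
  {A : HilbertianAlgebra H}

theorem inner_comul_left (A : HilbertianAlgebra H) (x : H) (t : HTensor H H) :
    ⟪A.comul x, t⟫_ℂ = ⟪x, A.μ t⟫_ℂ :=
  ContinuousLinearMap.adjoint_inner_left _ _ _

theorem comul_eq_tmul_iff {g : H} :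
    A.comul g = tmul g g ↔ ∀ x y, ⟪g, A.mul x y⟫_ℂ = ⟪g, x⟫_ℂ * ⟪g, y⟫_ℂ := by
  constructor
  · intro hg x y
    rw [← inner_tmul_tmul, ← hg, inner_comul_left, mul]
  · intro h
    have key : (innerSL ℂ (A.comul g) : HTensor H H →L[ℂ] ℂ) = innerSL ℂ (tmul g g) := by
      refine HTensor.clm_ext fun x y => ?_
      rw [innerSL_apply_apply, innerSL_apply_apply, inner_comul_left, inner_tmul_tmul]
      exact h x y
    refine ext_inner_right ℂ fun t => ?_
    simpa using DFunLike.congr_fun key t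

theorem inner_mul_of_mem_groupLike {g : H} (hg : g ∈ A.groupLike) (x y : H) :
    ⟪g, A.mul x y⟫_ℂ = ⟪g, x⟫_ℂ * ⟪g, y⟫_ℂ :=
  comul_eq_tmul_iff.1 hg.2 x y

theorem mul_add (A : HilbertianAlgebra H) (x y z : H) :
    A.mul x (y + z) = A.mul x y + A.mul x z := by
  simp [mul, tmul_add]

theorem add_mul (A : HilbertianAlgebra H) (x y z : H) :
    A.mul (x + y) z = A.mul x z + A.mul y z := by
  simp [mul, add_tmul]

theorem mul_smul (A : HilbertianAlgebra H) (c : ℂ) (x y : H) :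
    A.mul x (c • y) = c • A.mul x y := by
  simp [mul, tmul_smul]

theorem smul_mul (A : HilbertianAlgebra H) (c : ℂ) (x y : H) :
    A.mul (c • x) y = c • A.mul x y := by
  simp [mul, smul_tmul]

theorem mul_zero (A : HilbertianAlgebra H) (x : H) : A.mul x 0 = 0 := by
  simpa using A.mul_smul 0 x 0

theorem zero_mul (A : HilbertianAlgebra H) (x : H) : A.mul 0 x = 0 := by
  simpa using A.smul_mul 0 0 x

theorem mul_assoc (A : HilbertianAlgebra H) (x y z : H) :
    A.mul (A.mul x y) z = A.mul x (A.mul y z) :=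
  A.assoc x y z

theorem mul_comm (A : HilbertianAlgebra H) (x y : H) : A.mul x y = A.mul y x :=
  A.comm x y

/-! ### Banach algebra structure and orthogonality of group-likes -/

namespace IsSpecial

theorem μ_comul (hA : A.IsSpecial) (x : H) : A.μ (A.comul x) = x :=
  DFunLike.congr_fun hA x

theorem inner_comul_comul (hA : A.IsSpecial) (x y : H) :
    ⟪A.comul x, A.comul y⟫_ℂ = ⟪x, y⟫_ℂ := by
  rw [inner_comul_left, hA.μ_comul]

theorem norm_comul (hA : A.IsSpecial) (x : H) : ‖A.comul x‖ = ‖x‖ := by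
  rw [@norm_eq_sqrt_re_inner ℂ, hA.inner_comul_comul, ← @norm_eq_sqrt_re_inner ℂ]

theorem norm_μ_le (hA : A.IsSpecial) : ‖A.μ‖ ≤ 1 := by
  rw [← LinearIsometryEquiv.norm_map ContinuousLinearMap.adjoint A.μ]
  exact ContinuousLinearMap.opNorm_le_bound _ zero_le_one fun x => by
    rw [one_mul]; exact (hA.norm_comul x).le

theorem norm_mul_le (hA : A.IsSpecial) (x y : H) : ‖A.mul x y‖ ≤ ‖x‖ * ‖y‖ := by
  rw [← norm_tmul, ← one_mul ‖tmul x y‖]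
  exact A.μ.le_of_opNorm_le hA.norm_μ_le _

/-- A special Hilbertian algebra is a commutative Banach algebra. -/
noncomputable abbrev toNonUnitalNormedCommRing (hA : A.IsSpecial) : NonUnitalNormedCommRing H :=
  .ofMul A.mul A.mul_add A.add_mul A.zero_mul A.mul_zero A.mul_assoc A.mul_comm hA.norm_mul_le

/-- A proper modular ideal is orthogonal to a group-like element. -/
theorem exists_groupLike (hA : A.IsSpecial) {I : Submodule ℂ H} (hI : A.IsIdeal I) (hne : I ≠ ⊤)
    {u : H} (hu : ∀ x, x - A.mul u x ∈ I) :
    ∃ g ∈ A.groupLike, (∀ x ∈ I, ⟪g, x⟫_ℂ = 0) ∧ ⟪g, u⟫_ℂ = 1 := by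
  let _ := hA.toNonUnitalNormedCommRing
  let _ : NormedSpace ℂ H := ‹InnerProductSpace ℂ H›.toNormedSpace
  have : IsScalarTower ℂ H H := ⟨fun c x y => A.smul_mul c x y⟩
  have : SMulCommClass ℂ H H := ⟨fun c x y => (A.mul_smul c x y).symm⟩
  obtain ⟨φ, hmul, hφI, hφu⟩ := exists_character_of_modular I hI hne hu
  have hφ (x : H) : ⟪(InnerProductSpace.toDual ℂ H).symm φ, x⟫_ℂ = φ x :=
    InnerProductSpace.toDual_symm_apply
  refine ⟨(InnerProductSpace.toDual ℂ H).symm φ, ⟨fun h0 => ?_, ?_⟩, fun x hx => ?_, ?_⟩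
  · have h := hφ u
    rw [h0, inner_zero_left, hφu] at h
    exact zero_ne_one h
  · refine comul_eq_tmul_iff.2 fun x y => ?_
    rw [hφ, hφ, hφ]
    exact hmul x y
  · rw [hφ, hφI x hx]
  · rw [hφ, hφu]

theorem mul_self_of_mem_groupLike (hA : A.IsSpecial) {g : H} (hg : g ∈ A.groupLike) :
    A.mul g g = g := by
  rw [mul, ← hg.2, hA.μ_comul]

/-- Idempotence and multiplicativity make `⟪g, g⟫` a nonzero root of `t = t²`. -/
theorem inner_self_of_mem_groupLike (hA : A.IsSpecial) {g : H} (hg : g ∈ A.groupLike) :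
    ⟪g, g⟫_ℂ = 1 := by
  have h := inner_mul_of_mem_groupLike hg g g
  rw [hA.mul_self_of_mem_groupLike hg] at h
  exact (mul_eq_left₀ (inner_self_ne_zero.2 hg.1)).1 h.symm

/-- A character takes the value 0 or 1 on the idempotent `y`; since both vectors have norm one, the
value 1 would give `‖x - y‖² = 0`. -/
theorem inner_eq_zero_of_mem_groupLike (hA : A.IsSpecial) {x y : H} (hx : x ∈ A.groupLike)
    (hy : y ∈ A.groupLike) (hxy : x ≠ y) : ⟪x, y⟫_ℂ = 0 := by
  have h := inner_mul_of_mem_groupLike hx y y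
  rw [hA.mul_self_of_mem_groupLike hy] at h
  by_contra h0
  have h1 : ⟪x, y⟫_ℂ = 1 := (mul_eq_left₀ h0).1 h.symm
  have h2 : ⟪y, x⟫_ℂ = 1 := by rw [← inner_conj_symm, h1, map_one]
  refine hxy (sub_eq_zero.1 ((inner_self_eq_zero (𝕜 := ℂ)).1 ?_))
  rw [inner_sub_left, inner_sub_right, inner_sub_right, h1, h2,
    hA.inner_self_of_mem_groupLike hx, hA.inner_self_of_mem_groupLike hy]
  ring

/-- An idempotent which is orthogonal to all group-like elements is zero. -/
theorem eq_zero_of_idempotent (hA : A.IsSpecial) {z : H} (hz : A.mul z z = z)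
    (h : ∀ g ∈ A.groupLike, ⟪g, z⟫_ℂ = 0) : z = 0 := by
  by_contra h0
  let I : Submodule ℂ H :=
    { carrier := {x | A.mul z x = 0}
      zero_mem' := A.mul_zero z
      add_mem' := fun {x y} (hx : A.mul z x = 0) (hy : A.mul z y = 0) =>
        show A.mul z (x + y) = 0 by rw [A.mul_add, hx, hy, add_zero]
      smul_mem' := fun c x (hx : A.mul z x = 0) =>
        show A.mul z (c • x) = 0 by rw [A.mul_smul, hx, smul_zero] }
  have hI : A.IsIdeal I := fun x y (hy : A.mul z y = 0) => by
    change A.mul z (A.mul x y) = 0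
    rw [← A.mul_assoc, A.mul_comm z x, A.mul_assoc, hy, A.mul_zero]
  have hne : I ≠ ⊤ := fun htop => by
    have hzI : A.mul z z = 0 := (htop ▸ Submodule.mem_top : z ∈ I)
    exact h0 (hz.symm.trans hzI)
  -- The idempotent `z` is itself a unit modulo its annihilator, so some character takes the value 1
  -- at it.
  obtain ⟨g, hg, -, hgz⟩ := hA.exists_groupLike hI hne (u := z) fun x => by
    change A.mul z (x - A.mul z x) = 0
    have h1 : A.mul z (x - A.mul z x) + A.mul z (A.mul z x) = A.mul z x := by
      rw [← A.mul_add, sub_add_cancel]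
    rwa [← A.mul_assoc, hz, add_eq_right] at h1
  rw [h g hg] at hgz
  exact zero_ne_one hgz

theorem mul_eq_zero_of_mem_groupLike (hA : A.IsSpecial) {x y : H} (hx : x ∈ A.groupLike)
    (hy : y ∈ A.groupLike) (hxy : x ≠ y) : A.mul x y = 0 := by
  refine hA.eq_zero_of_idempotent ?_ fun g hg => ?_
  · rw [A.mul_assoc, ← A.mul_assoc y x y, A.mul_comm y x, A.mul_assoc x y y, ← A.mul_assoc x x,
      hA.mul_self_of_mem_groupLike hx, hA.mul_self_of_mem_groupLike hy]
  · rw [inner_mul_of_mem_groupLike hg]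
    by_cases h : g = x
    · rw [hA.inner_eq_zero_of_mem_groupLike hg hy (h ▸ hxy), MulZeroClass.mul_zero]
    · rw [hA.inner_eq_zero_of_mem_groupLike hg hx h, MulZeroClass.zero_mul]

/-! ### The radical and its orthogonal complement -/

theorem isMaximalModularIdeal_orthogonal (hA : A.IsSpecial) {g : H} (hg : g ∈ A.groupLike) :
    A.IsMaximalModularIdeal (ℂ ∙ g)ᗮ := by
  have hgg := hA.inner_self_of_mem_groupLike hg
  refine ⟨⟨fun x y hy => ?_, g, fun x => ?_⟩, fun htop => ?_, fun K _ hK => ?_⟩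
  · rw [Submodule.mem_orthogonal_singleton_iff_inner_right] at hy ⊢
    rw [inner_mul_of_mem_groupLike hg, hy, MulZeroClass.mul_zero]
  · rw [Submodule.mem_orthogonal_singleton_iff_inner_right, inner_sub_right,
      inner_mul_of_mem_groupLike hg, hgg, one_mul, sub_self]
  · have h : g ∈ (ℂ ∙ g)ᗮ := htop ▸ Submodule.mem_top
    rw [Submodule.mem_orthogonal_singleton_iff_inner_right, hgg] at h
    exact one_ne_zero h
  · obtain ⟨hle, k, hk, hk'⟩ := SetLike.lt_iff_le_and_exists.1 hK
    rw [Submodule.mem_orthogonal_singleton_iff_inner_right] at hk'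
    refine eq_top_iff.2 fun x _ => ?_
    -- The ideal contains a hyperplane and a vector `k` outside it, so it is everything.
    have h : x - (⟪g, x⟫_ℂ / ⟪g, k⟫_ℂ) • k ∈ K := hle <| by
      rw [Submodule.mem_orthogonal_singleton_iff_inner_right, inner_sub_right, inner_smul_right,
        div_mul_cancel₀ _ hk', sub_self]
    simpa using K.add_mem h (K.smul_mem (⟪g, x⟫_ℂ / ⟪g, k⟫_ℂ) hk)

/-- The Jacobson radical is the orthogonal complement of the group-like elements. -/
theorem jacobson_eq (hA : A.IsSpecial) : A.jacobson = (Submodule.span ℂ A.groupLike)ᗮ := by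
  apply le_antisymm
  · intro x hx
    refine (Submodule.mem_orthogonal _ _).2 fun v hv => ?_
    induction hv using Submodule.span_induction with
    | mem g hg =>
      rw [← Submodule.mem_orthogonal_singleton_iff_inner_right]
      exact (Submodule.mem_sInf.1 hx) _ (hA.isMaximalModularIdeal_orthogonal hg)
    | zero => exact inner_zero_left _
    | add v w _ _ hv hw => rw [inner_add_left, hv, hw, add_zero]
    | smul c v _ hv => rw [inner_smul_left, hv, MulZeroClass.mul_zero]
  · refine le_sInf fun M ⟨⟨hM, u, hu⟩, hne, hmax⟩ => ?_
    obtain ⟨g, hg, hgM, -⟩ := hA.exists_groupLike hM hne hu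
    have hle : M ≤ (ℂ ∙ g)ᗮ := fun x hx =>
      Submodule.mem_orthogonal_singleton_iff_inner_right.2 (hgM x hx)
    have hg' := hA.isMaximalModularIdeal_orthogonal hg
    have hM' : M = (ℂ ∙ g)ᗮ := hle.eq_of_not_lt fun hlt => hg'.2.1 (hmax _ hg'.1.1 hlt)
    rw [hM']
    exact Submodule.orthogonal_le
      ((Submodule.span_singleton_le_iff_mem _ _).2 (Submodule.subset_span hg))

theorem orthogonal_jacobson (hA : A.IsSpecial) :
    A.jacobsonᗮ = (Submodule.span ℂ A.groupLike).topologicalClosure := by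
  rw [hA.jacobson_eq, Submodule.orthogonal_orthogonal_eq_closure]

theorem isOrthogonalDirectSum_jacobson (hA : A.IsSpecial) :
    IsOrthogonalDirectSum A.jacobson A.jacobsonᗮ := by
  have hc : IsClosed (A.jacobson : Set H) := by
    rw [hA.jacobson_eq]
    exact Submodule.isClosed_orthogonal _
  have : CompleteSpace A.jacobson := hc.completeSpace_coe
  exact ⟨hc, Submodule.isClosed_orthogonal _, Submodule.isOrtho_orthogonal_right _,
    Submodule.isCompl_orthogonal _⟩

theorem isSubcoalgebra_orthogonal_jacobson (hA : A.IsSpecial) :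
    A.IsSubcoalgebra A.jacobsonᗮ := by
  refine ⟨Submodule.isClosed_orthogonal _, ?_⟩
  have hcl : IsClosed
      ((subTensor A.jacobsonᗮ A.jacobsonᗮ).comap A.comul.toLinearMap : Set H) :=
    (isClosed_subTensor _ _).preimage A.comul.continuous
  suffices h : A.jacobsonᗮ ≤ (subTensor A.jacobsonᗮ A.jacobsonᗮ).comap A.comul.toLinearMap from
    fun x hx => h hx
  have hG : A.groupLike ⊆ A.jacobsonᗮ := by
    rw [hA.orthogonal_jacobson]
    exact Submodule.subset_span.trans (Submodule.le_topologicalClosure _)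
  conv_lhs => rw [hA.orthogonal_jacobson]
  refine Submodule.topologicalClosure_minimal _ (Submodule.span_le.2 fun g hg => ?_) hcl
  change A.comul g ∈ subTensor A.jacobsonᗮ A.jacobsonᗮ
  rw [hg.2]
  exact tmul_mem_subTensor (hG hg) (hG hg)

theorem mul_mem_orthogonal_jacobson (hA : A.IsSpecial) {x y : H} (hx : x ∈ A.jacobsonᗮ)
    (hy : y ∈ A.jacobsonᗮ) : A.mul x y ∈ A.jacobsonᗮ := by
  -- Supplies joint continuity of the product, which carries closure under products from the span to
  -- its closure.
  let _ := hA.toNonUnitalNormedCommRing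
  have hS : ∀ x ∈ Submodule.span ℂ A.groupLike, ∀ y ∈ Submodule.span ℂ A.groupLike,
      A.mul x y ∈ Submodule.span ℂ A.groupLike := by
    intro x hx y hy
    induction hx, hy using Submodule.span_induction₂ with
    | mem_mem x y hx hy =>
      by_cases h : x = y
      · subst h
        rw [hA.mul_self_of_mem_groupLike hx]
        exact Submodule.subset_span hx
      · rw [hA.mul_eq_zero_of_mem_groupLike hx hy h]
        exact Submodule.zero_mem _
    | zero_left y _ => exact (A.zero_mul y).symm ▸ Submodule.zero_mem _
    | zero_right x _ => exact (A.mul_zero x).symm ▸ Submodule.zero_mem _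
    | add_left x y z _ _ _ h₁ h₂ => exact A.add_mul x y z ▸ Submodule.add_mem _ h₁ h₂
    | add_right x y z _ _ _ h₁ h₂ => exact A.mul_add x y z ▸ Submodule.add_mem _ h₁ h₂
    | smul_left c x y _ _ h => exact A.smul_mul c x y ▸ Submodule.smul_mem _ c h
    | smul_right c x y _ _ h => exact A.mul_smul c x y ▸ Submodule.smul_mem _ c h
  have hcont : Continuous fun p : H × H => A.mul p.1 p.2 := continuous_mul (M := H)
  rw [hA.orthogonal_jacobson] at hx hy ⊢
  exact map_mem_closure₂ hcont hx hy hS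

theorem isSubalgebra_orthogonal_jacobson (hA : A.IsSpecial) : A.IsSubalgebra A.jacobsonᗮ := by
  refine ⟨Submodule.isClosed_orthogonal _, ?_⟩
  rintro _ ⟨t, rfl⟩
  change A.μ (mapTensor A.jacobsonᗮ.subtypeₗᵢ A.jacobsonᗮ.subtypeₗᵢ t) ∈ A.jacobsonᗮ
  refine (Submodule.mem_orthogonal _ _).2 fun j hj => ?_
  -- Testing against `j ∈ J` turns membership into the vanishing of a bounded functional, which can
  -- be checked on elementary tensors.
  have key : (innerSL ℂ j).comp (A.μ.comp
      (mapTensor A.jacobsonᗮ.subtypeₗᵢ A.jacobsonᗮ.subtypeₗᵢ)) = 0 := by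
    refine HTensor.clm_ext fun x y => ?_
    simp only [ContinuousLinearMap.comp_apply, mapTensor_tmul, innerSL_apply_apply,
      zero_apply]
    exact (Submodule.mem_orthogonal _ _).1 (hA.mul_mem_orthogonal_jacobson x.2 y.2) j hj
  simpa using DFunLike.congr_fun key t

end IsSpecial

end HilbertianAlgebra

end Hilbertian

theorem mainTheorem10 {H : Type*} [NormedAddCommGroup H] [InnerProductSpace ℂ H] [CompleteSpace H]
    [DecidableEq H]     (A : Hilbertian.HilbertianAlgebra H) (hA : A.IsSpecial) :
    Hilbertian.IsOrthogonalDirectSum A.jacobson A.jacobsonᗮ ∧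
    A.IsSubalgebra A.jacobsonᗮ ∧
    A.IsSubcoalgebra A.jacobsonᗮ ∧
    ∀ x ∈ A.groupLike, ∀ y ∈ A.groupLike, A.mul x y = if x = y then x else 0 := by
  refine ⟨hA.isOrthogonalDirectSum_jacobson, hA.isSubalgebra_orthogonal_jacobson,
    hA.isSubcoalgebra_orthogonal_jacobson, fun x hx y hy => ?_⟩
  split_ifs with h
  · subst h
    exact hA.mul_self_of_mem_groupLike hx
  · exact hA.mul_eq_zero_of_mem_groupLike hx hy h
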